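/- Let $\mathbb{F}$ be a field of characteristic zero, let $q\in\mathbb{F}$ be nonzero and not a root of unity, and let $r\in\mathbb{F}$ be nonzero. Let $\mathcal{U}_q(r,0)$ be the unital associative $\mathbb{F}$-algebra with generators $A,B$ and the single relation $AB-qBA=rA$, regarded as a Lie algebra with bracket $[X,Y]=XY-YX$, and put $C:=[A,B]=AB-BA$. Let $\mathcal{L}_{(r,0)}$ be the Lie subalgebra of $\mathcal{U}_q(r,0)$ generated by $A$ and $B$, that is, the set of all Lie polynomials in $A,B$. Then the elements $$A,\qquad B,\qquad B^nC^m\quad (n\ge 0,\ m\ge 1),\qquad C^mA^k\quad (m,k\ge 1)$$ form a basis of $\mathcal{L}_{(r,0)}$ as an $\mathbb{F}$-vector space. -/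

import Mathlib

attribute [local instance 100] LieRing.ofAssociativeRing

namespace QDeformed

universe u

/-- The two letters of the free monoid on which the algebras are presented. -/
inductive Letter : Type
  | A : Letter
  | B : Letter

/-- The single defining relation `AB - qBA = rA + sB`, on the free algebra on the letters `A, B`. -/
inductive Rel {F : Type u} [Field F] (q r s : F) :
    FreeAlgebra F Letter → FreeAlgebra F Letter → Prop
  | rel : Rel q r s
      (FreeAlgebra.ι F Letter.A * FreeAlgebra.ι F Letter.B
        - q • (FreeAlgebra.ι F Letter.B * FreeAlgebra.ι F Letter.A))
      (r • FreeAlgebra.ι F Letter.A + s • FreeAlgebra.ι F Letter.B)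

/-- The unital associative algebra `U_q(r, s)` with generators `A, B` and
relation `AB - qBA = rA + sB`: the free algebra modulo the two-sided ideal generated by
the relation. -/
abbrev Uq {F : Type u} [Field F] (q r s : F) : Type u := RingQuot (Rel q r s)

noncomputable section

/-- The generator `A` of `U_q(r, s)`. -/
def genA {F : Type u} [Field F] (q r s : F) : Uq q r s :=
  RingQuot.mkAlgHom F (Rel q r s) (FreeAlgebra.ι F Letter.A)

/-- The generator `B` of `U_q(r, s)`. -/
def genB {F : Type u} [Field F] (q r s : F) : Uq q r s :=
  RingQuot.mkAlgHom F (Rel q r s) (FreeAlgebra.ι F Letter.B)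

/-- The element `C = [A, B] = AB - BA` of `U_q(r, s)`. -/
def elemC {F : Type u} [Field F] (q r s : F) : Uq q r s :=
  genA q r s * genB q r s - genB q r s * genA q r s

/-- `L_(r,s)`: the Lie subalgebra of `U_q(r, s)` (with bracket `[X, Y] = XY - YX`)
generated by `A` and `B`. Its elements are the Lie polynomials in `A, B`. -/
def lieL {F : Type u} [Field F] (q r s : F) : LieSubalgebra F (Uq q r s) :=
  LieSubalgebra.lieSpan F (Uq q r s) {genA q r s, genB q r s}

/-- Index set of the list `A`, `B`, `B^n C^m` (`n ≥ 0`, `m ≥ 1`), `C^m A^k` (`m, k ≥ 1`). -/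
inductive Idx : Type
  | a : Idx
  | b : Idx
  | bc (n : ℕ) (m : ℕ+) : Idx
  | ca (m k : ℕ+) : Idx

/-- The listed elements `A`, `B`, `B^n C^m`, `C^m A^k`, as elements of `U_q(r, s)`. -/
def listed {F : Type u} [Field F] (q r s : F) : Idx → Uq q r s
  | Idx.a => genA q r s
  | Idx.b => genB q r s
  | Idx.bc n m => genB q r s ^ n * elemC q r s ^ (m : ℕ)
  | Idx.ca m k => elemC q r s ^ (m : ℕ) * genA q r s ^ (k : ℕ)

end

end QDeformed

/-!
Put `D = (q - 1) B + r`. The relation `AB - qBA = rA` says exactly that `A D = q D A`, and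
`C = [A, B] = D A`, so `U_q(r, 0)` is a quantum plane in `D` and `A`, in which `B` is an affine
function of `D`. Hence

`[D^i A^j, D^k A^l] = (q^(j k) - q^(i l)) D^(i+k) A^(j+l)`.

The coefficient vanishes whenever `i + k = 0` or `j + l = 0`, so every commutator lies in the span
`N` of the monomials `D^i A^j` with `i, j ≥ 1`. Conversely all of these are Lie polynomials in `A`
and `B`: starting from `C = D A`, bracketing with `A` raises `j` with the nonzero factor `q^i - 1`,
and bracketing with `B` raises `i` with the factor `(q^j - 1) / (q - 1)`. So `L = F A + F B + N`.
Since `C^m` is a nonzero multiple of `D^m A^m`, the elements `B^n C^m` and `C^m A^k` span `N`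
(`range_listed_subset_lieL`, `lieL_le_span`).

For linear independence (`linearIndependent_listed`), let the algebra act on `F[X][Y]`, with `B` as
multiplication by `X` and `A` as the substitution `X ↦ qX + r` followed by multiplication by `Y`.
Applied to `1`, the listed elements give products `p(X) Y^j` with pairwise different bidegrees.
-/

namespace QDeformed

/-! ### Monomials in a quantum plane -/

section QuantumPlane

variable {F R : Type*} [Field F] [Ring R] [Algebra F R] {q : F} {a d : R}

theorem pow_mul_of_qcomm (h : a * d = q • (d * a)) (j : ℕ) :
    a ^ j * d = q ^ j • (d * a ^ j) := by
  induction j with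
  | zero => simp
  | succ j ih =>
    rw [pow_succ, mul_assoc, h, mul_smul_comm, ← mul_assoc, ih, smul_mul_assoc, smul_smul,
      mul_assoc, pow_succ' q]

theorem pow_mul_pow_of_qcomm (h : a * d = q • (d * a)) (j k : ℕ) :
    a ^ j * d ^ k = q ^ (j * k) • (d ^ k * a ^ j) := by
  induction k with
  | zero => simp
  | succ k ih =>
    rw [pow_succ, ← mul_assoc, ih, smul_mul_assoc, mul_assoc, pow_mul_of_qcomm h, mul_smul_comm,
      smul_smul, ← mul_assoc, ← pow_add, Nat.mul_succ]

theorem monomial_mul_monomial_of_qcomm (h : a * d = q • (d * a)) (i j k l : ℕ) :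
    (d ^ i * a ^ j) * (d ^ k * a ^ l) = q ^ (j * k) • (d ^ (i + k) * a ^ (j + l)) := by
  rw [mul_assoc, ← mul_assoc (a ^ j), pow_mul_pow_of_qcomm h, smul_mul_assoc, mul_smul_comm,
    mul_assoc, ← mul_assoc (d ^ i), ← pow_add, ← pow_add]

theorem lie_monomial_of_qcomm (h : a * d = q • (d * a)) (i j k l : ℕ) :
    ⁅d ^ i * a ^ j, d ^ k * a ^ l⁆
      = (q ^ (j * k) - q ^ (i * l)) • (d ^ (i + k) * a ^ (j + l)) := by
  rw [Ring.lie_def, monomial_mul_monomial_of_qcomm h, monomial_mul_monomial_of_qcomm h,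
    add_comm k i, add_comm l j, mul_comm l i, sub_smul]

theorem mul_pow_of_qcomm (h : a * d = q • (d * a)) (m : ℕ) :
    (d * a) ^ m = q ^ (m.choose 2) • (d ^ m * a ^ m) := by
  induction m with
  | zero => simp
  | succ m ih =>
    have e := monomial_mul_monomial_of_qcomm h m m 1 1
    simp only [pow_one, mul_one] at e
    rw [pow_succ, ih, smul_mul_assoc, e, smul_smul, ← pow_add,
      Nat.choose_succ_succ' m 1, Nat.choose_one_right, add_comm (m.choose 2)]

/-- Every commutator in a quantum plane is a combination of the monomials involving both
generators. -/
theorem lie_mem_span_of_qcomm (h : a * d = q • (d * a)) {x y : R}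
    (hx : x ∈ Submodule.span F (Set.range fun p : ℕ × ℕ => d ^ p.1 * a ^ p.2))
    (hy : y ∈ Submodule.span F (Set.range fun p : ℕ × ℕ => d ^ p.1 * a ^ p.2)) :
    ⁅x, y⁆ ∈ Submodule.span F
      (Set.range fun p : ℕ × ℕ => d ^ (p.1 + 1) * a ^ (p.2 + 1)) := by
  induction hx, hy using Submodule.span_induction₂ with
  | mem_mem x y hx hy =>
    obtain ⟨⟨i, j⟩, rfl⟩ := hx
    obtain ⟨⟨k, l⟩, rfl⟩ := hy
    dsimp only
    rw [lie_monomial_of_qcomm h]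
    rcases Nat.eq_zero_or_eq_succ_pred (i + k) with hik | hik
    · obtain ⟨rfl, rfl⟩ : i = 0 ∧ k = 0 := by omega
      simp
    rcases Nat.eq_zero_or_eq_succ_pred (j + l) with hjl | hjl
    · obtain ⟨rfl, rfl⟩ : j = 0 ∧ l = 0 := by omega
      simp
    rw [hik, hjl]
    exact Submodule.smul_mem _ _ (Submodule.subset_span ⟨(_, _), rfl⟩)
  | zero_left y _ => simp
  | zero_right x _ => simp
  | add_left x y z _ _ _ h₁ h₂ => rw [add_lie]; exact add_mem h₁ h₂
  | add_right x y z _ _ _ h₁ h₂ => rw [lie_add]; exact add_mem h₁ h₂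
  | smul_left c x y _ _ h₁ => rw [smul_lie]; exact Submodule.smul_mem _ _ h₁
  | smul_right c x y _ _ h₁ => rw [lie_smul]; exact Submodule.smul_mem _ _ h₁

theorem lie_smul_add_algebraMap (c s : F) (x y : R) :
    ⁅x, c • y + algebraMap F R s⁆ = c • ⁅x, y⁆ := by
  simp only [Ring.lie_def, mul_add, add_mul, Algebra.commutes, mul_smul_comm, smul_mul_assoc,
    smul_sub]
  abel

end QuantumPlane

/-! ### The algebra as a quantum plane -/

section Algebra

variable {F : Type*} [Field F]

theorem genA_mul_genB (q r s : F) :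
    genA q r s * genB q r s - q • (genB q r s * genA q r s)
      = r • genA q r s + s • genB q r s := by
  have h := RingQuot.mkAlgHom_rel F (Rel.rel (q := q) (r := r) (s := s))
  simp only [map_sub, map_mul, map_smul, map_add] at h
  exact h

/-- The element `D = (q - 1) B + r` of `U_q(r, 0)`, which `q`-commutes with `A`. -/
noncomputable def elemD (q r : F) : Uq q r 0 :=
  (q - 1) • genB q r 0 + algebraMap F (Uq q r 0) r

theorem genA_mul_genB_zero (q r : F) :
    genA q r 0 * genB q r 0 = q • (genB q r 0 * genA q r 0) + r • genA q r 0 := by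
  rw [← sub_eq_iff_eq_add', genA_mul_genB, zero_smul, add_zero]

theorem genA_mul_elemD (q r : F) :
    genA q r 0 * elemD q r = q • (elemD q r * genA q r 0) := by
  simp only [elemD, mul_add, add_mul, mul_smul_comm, smul_mul_assoc, genA_mul_genB_zero,
    Algebra.algebraMap_eq_smul_one, mul_one, one_mul]
  module

theorem elemC_eq (q r : F) : elemC q r 0 = elemD q r * genA q r 0 := by
  simp only [elemC, elemD, add_mul, smul_mul_assoc, genA_mul_genB_zero,
    Algebra.algebraMap_eq_smul_one, one_mul]
  module

theorem elemC_pow (q r : F) (m : ℕ) :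
    elemC q r 0 ^ m = q ^ (m.choose 2) • (elemD q r ^ m * genA q r 0 ^ m) := by
  rw [elemC_eq, mul_pow_of_qcomm (genA_mul_elemD q r)]

theorem genB_eq {q : F} (hq1 : q - 1 ≠ 0) (r : F) :
    genB q r 0 = (q - 1)⁻¹ • (elemD q r - r • (1 : Uq q r 0)) := by
  rw [elemD, Algebra.algebraMap_eq_smul_one, add_sub_cancel_right, smul_smul,
    inv_mul_cancel₀ hq1, one_smul]

/-- Since `B` and `D` differ by a scaling and a scalar, brackets with `B` are multiples of brackets
with `D`. -/
theorem lie_elemD (q r : F) (x : Uq q r 0) : ⁅x, elemD q r⁆ = (q - 1) • ⁅x, genB q r 0⁆ := by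
  rw [elemD]
  exact lie_smul_add_algebraMap (F := F) (R := Uq q r 0) _ _ _ _

/-! ### The listed elements span the Lie algebra -/

theorem monomial_mem_lieL {q : F} (hroot : ∀ n : ℕ, 1 ≤ n → q ^ n ≠ 1) (r : F) (i j : ℕ) :
    elemD q r ^ (i + 1) * genA q r 0 ^ (j + 1) ∈ lieL q r 0 := by
  have hA : genA q r 0 ∈ lieL q r 0 := LieSubalgebra.subset_lieSpan (by simp)
  have hB : genB q r 0 ∈ lieL q r 0 := LieSubalgebra.subset_lieSpan (by simp)
  have hz (n : ℕ) : q ^ (n + 1) - 1 ≠ 0 := sub_ne_zero.2 (hroot _ (by omega))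
  have cancel {c : F} (hc : c ≠ 0) {x : Uq q r 0} (h : c • x ∈ lieL q r 0) :
      x ∈ lieL q r 0 := ((lieL q r 0).toSubmodule.smul_mem_iff hc).1 h
  induction i with
  | zero =>
    induction j with
    | zero =>
      have := (lieL q r 0).lie_mem hA hB
      rwa [Ring.lie_def, ← elemC, elemC_eq, ← pow_one (elemD q r), ← pow_one (genA q r 0)] at this
    | succ j ih =>
      have := (lieL q r 0).lie_mem hA ih
      have e := lie_monomial_of_qcomm (genA_mul_elemD q r) 0 1 (0 + 1) (j + 1)
      rw [pow_zero, one_mul, pow_one] at e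
      rw [e, zero_mul, pow_zero, one_mul, zero_add, add_comm 1 (j + 1)] at this
      exact cancel (hz 0) this
  | succ i ih =>
    have e := lie_monomial_of_qcomm (genA_mul_elemD q r) (i + 1) (j + 1) 1 0
    rw [pow_zero, mul_one, pow_one, lie_elemD, mul_one, mul_zero, pow_zero, add_zero] at e
    refine cancel (hz j) ?_
    rw [← e]
    exact (lieL q r 0).toSubmodule.smul_mem _ ((lieL q r 0).lie_mem ih hB)

theorem genB_pow_mul_monomial_mem_lieL {q : F} (hroot : ∀ n : ℕ, 1 ≤ n → q ^ n ≠ 1) (r : F)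
    (n i j : ℕ) :
    genB q r 0 ^ n * (elemD q r ^ (i + 1) * genA q r 0 ^ (j + 1)) ∈ lieL q r 0 := by
  have hq1 : q - 1 ≠ 0 := sub_ne_zero.2 (by simpa using hroot 1 le_rfl)
  induction n generalizing i with
  | zero => simpa using monomial_mem_lieL hroot r i j
  | succ n ih =>
    have e : genB q r 0 ^ (n + 1) * (elemD q r ^ (i + 1) * genA q r 0 ^ (j + 1))
        = (q - 1)⁻¹ • (genB q r 0 ^ n * (elemD q r ^ (i + 1 + 1) * genA q r 0 ^ (j + 1))
          - r • (genB q r 0 ^ n * (elemD q r ^ (i + 1) * genA q r 0 ^ (j + 1)))) := by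
      rw [pow_succ (genB q r 0), mul_assoc]
      nth_rw 2 [genB_eq hq1]
      rw [smul_mul_assoc, mul_smul_comm, sub_mul, mul_sub, ← mul_assoc (elemD q r), ← pow_succ',
        smul_mul_assoc, one_mul, mul_smul_comm]
    rw [e]
    exact (lieL q r 0).toSubmodule.smul_mem _
      (sub_mem (ih (i + 1)) ((lieL q r 0).toSubmodule.smul_mem _ (ih i)))

theorem range_listed_subset_lieL {q : F} (hroot : ∀ n : ℕ, 1 ≤ n → q ^ n ≠ 1) (r : F) :
    Set.range (listed q r 0) ⊆ lieL q r 0 := by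
  rintro _ ⟨i, rfl⟩
  cases i with
  | a => exact LieSubalgebra.subset_lieSpan (by simp [listed])
  | b => exact LieSubalgebra.subset_lieSpan (by simp [listed])
  | bc n m =>
    obtain ⟨m, rfl⟩ := Nat.exists_eq_add_one.2 m.pos |>.imp fun k hk =>
      (PNat.coe_injective (by simpa using hk) : m = Nat.succPNat k)
    rw [listed, elemC_pow, mul_smul_comm]
    exact (lieL q r 0).toSubmodule.smul_mem _ (genB_pow_mul_monomial_mem_lieL hroot r n m m)
  | ca m k =>
    obtain ⟨m, rfl⟩ := Nat.exists_eq_add_one.2 m.pos |>.imp fun k hk =>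
      (PNat.coe_injective (by simpa using hk) : m = Nat.succPNat k)
    rw [listed, elemC_pow, smul_mul_assoc, mul_assoc, ← pow_add]
    refine (lieL q r 0).toSubmodule.smul_mem _ ?_
    have := monomial_mem_lieL hroot r m (m + k)
    rwa [show m + (k : ℕ) + 1 = m + 1 + k by omega] at this

theorem elemD_pow_mul_elemC_pow_mem_span (q r : F) (n : ℕ) (m : ℕ+) :
    elemD q r ^ n * elemC q r 0 ^ (m : ℕ) ∈ Submodule.span F (Set.range (listed q r 0)) := by
  have hle : Set.range (fun k => genB q r 0 ^ k * elemC q r 0 ^ (m : ℕ))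
      ⊆ Set.range (listed q r 0) := by
    rintro _ ⟨k, rfl⟩
    exact ⟨Idx.bc k m, rfl⟩
  -- The span of the `B^k C^m` with `m` fixed is stable under left multiplication by `D`.
  have hD (x : Uq q r 0)
      (hx : x ∈ Submodule.span F (Set.range fun k => genB q r 0 ^ k * elemC q r 0 ^ (m : ℕ))) :
      elemD q r * x
        ∈ Submodule.span F (Set.range fun k => genB q r 0 ^ k * elemC q r 0 ^ (m : ℕ)) := by
    induction hx using Submodule.span_induction with
    | mem x hx =>
      obtain ⟨k, rfl⟩ := hx
      rw [elemD, add_mul, smul_mul_assoc, Algebra.algebraMap_eq_smul_one, smul_mul_assoc, one_mul,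
        ← mul_assoc, ← pow_succ']
      exact add_mem (Submodule.smul_mem _ _ (Submodule.subset_span ⟨k + 1, rfl⟩))
        (Submodule.smul_mem _ _ (Submodule.subset_span ⟨k, rfl⟩))
    | zero => simp
    | add x y _ _ hx hy => rw [mul_add]; exact add_mem hx hy
    | smul c x _ hx => rw [mul_smul_comm]; exact Submodule.smul_mem _ _ hx
  refine Submodule.span_mono hle ?_
  induction n with
  | zero => exact Submodule.subset_span ⟨0, by simp⟩
  | succ n ih =>
    rw [pow_succ', mul_assoc]
    exact hD _ ih

theorem monomial_mem_span {q : F} (hq : q ≠ 0) (r : F) (i j : ℕ) :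
    elemD q r ^ (i + 1) * genA q r 0 ^ (j + 1) ∈ Submodule.span F (Set.range (listed q r 0)) := by
  have key (m : ℕ) : elemD q r ^ m * genA q r 0 ^ m
      = (q ^ (m.choose 2))⁻¹ • elemC q r 0 ^ m := by
    rw [elemC_pow, smul_smul, inv_mul_cancel₀ (pow_ne_zero _ hq), one_smul]
  rcases le_or_gt j i with h | h
  · obtain ⟨n, rfl⟩ := Nat.exists_eq_add_of_le h
    rw [show j + n + 1 = n + (j + 1) by omega, pow_add, mul_assoc, key, mul_smul_comm]
    exact Submodule.smul_mem _ _ (elemD_pow_mul_elemC_pow_mem_span q r n (Nat.succPNat j))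
  · obtain ⟨n, rfl⟩ := Nat.exists_eq_add_of_lt h
    rw [show i + n + 1 + 1 = (i + 1) + (n + 1) by omega, pow_add (genA q r 0), ← mul_assoc, key,
      smul_mul_assoc]
    exact Submodule.smul_mem _ _
      (Submodule.subset_span ⟨Idx.ca (Nat.succPNat i) (Nat.succPNat n), rfl⟩)

theorem listed_mem_span_monomial {q : F} (hq1 : q - 1 ≠ 0) (r : F) (i : Idx) :
    listed q r 0 i ∈
      Submodule.span F (Set.range fun p : ℕ × ℕ => elemD q r ^ p.1 * genA q r 0 ^ p.2) := by
  set M := Submodule.span F (Set.range fun p : ℕ × ℕ => elemD q r ^ p.1 * genA q r 0 ^ p.2)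
  have hM (i j : ℕ) : elemD q r ^ i * genA q r 0 ^ j ∈ M := Submodule.subset_span ⟨(i, j), rfl⟩
  have hD (x : Uq q r 0) (hx : x ∈ M) : elemD q r * x ∈ M := by
    induction hx using Submodule.span_induction with
    | mem x hx =>
      obtain ⟨⟨i, j⟩, rfl⟩ := hx
      simpa only [← mul_assoc, ← pow_succ'] using hM (i + 1) j
    | zero => simp
    | add x y _ _ hx hy => rw [mul_add]; exact add_mem hx hy
    | smul c x _ hx => rw [mul_smul_comm]; exact Submodule.smul_mem _ _ hx
  have hB (n : ℕ) (x : Uq q r 0) (hx : x ∈ M) : genB q r 0 ^ n * x ∈ M := by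
    induction n with
    | zero => simpa
    | succ n ih =>
      rw [pow_succ', mul_assoc]
      nth_rw 1 [genB_eq hq1]
      rw [smul_mul_assoc, sub_mul, smul_mul_assoc, one_mul]
      exact Submodule.smul_mem _ _ (sub_mem (hD _ ih) (Submodule.smul_mem _ _ ih))
  cases i with
  | a => simpa [listed] using hM 0 1
  | b => simpa [listed] using hB 1 1 (by simpa using hM 0 0)
  | bc n m =>
    rw [listed, elemC_pow]
    exact hB _ _ (Submodule.smul_mem _ _ (hM m m))
  | ca m k =>
    rw [listed, elemC_pow, smul_mul_assoc, mul_assoc, ← pow_add]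
    exact Submodule.smul_mem _ _ (hM _ _)

/-- The span of the listed elements is closed under the bracket, because it contains every
commutator, and so it contains the Lie algebra generated by `A` and `B`. -/
theorem lieL_le_span {q : F} (hq : q ≠ 0) (hq1 : q - 1 ≠ 0) (r : F) :
    (lieL q r 0).toSubmodule ≤ Submodule.span F (Set.range (listed q r 0)) := by
  have hle := Submodule.span_le.2 (Set.range_subset_iff.2 (listed_mem_span_monomial hq1 r))
  intro x hx
  induction hx using LieSubalgebra.lieSpan_induction with
  | mem x hx =>
    rcases hx with rfl | rfl
    · exact Submodule.subset_span ⟨Idx.a, rfl⟩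
    · exact Submodule.subset_span ⟨Idx.b, rfl⟩
  | zero => exact zero_mem _
  | add x y _ _ hx hy => exact add_mem hx hy
  | smul c x _ hx => exact Submodule.smul_mem _ c hx
  | lie x y _ _ hx hy =>
    have h := lie_mem_span_of_qcomm (genA_mul_elemD q r) (hle hx) (hle hy)
    refine Submodule.span_le.2 ?_ h
    rintro _ ⟨p, rfl⟩
    exact monomial_mem_span hq r p.1 p.2

/-! ### Linear independence -/

open Polynomial

/-- Elements `p_i(X) Y^(e i)` of `F[X][Y]` with pairwise distinct bidegrees are linearly
independent. -/
theorem linearIndependent_monomial {ι : Type*} (p : ι → F[X]) (e : ι → ℕ) (hp : ∀ i, p i ≠ 0)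
    (hinj : Function.Injective fun i => ((p i).natDegree, e i)) :
    LinearIndependent F fun i => (monomial (e i) (p i) : F[X][X]) := by
  classical
  rw [linearIndependent_iff']
  intro s g hg
  by_contra! hne
  obtain ⟨i₀, hi₀, hgi₀⟩ := hne
  -- Compare coefficients at the bidegree of an index of maximal `X`-degree in the relation.
  obtain ⟨i, hi, hmax⟩ := Finset.exists_max_image (s.filter fun i => g i ≠ 0)
    (fun i => (p i).natDegree) ⟨i₀, Finset.mem_filter.2 ⟨hi₀, hgi₀⟩⟩
  obtain ⟨his, hgi⟩ := Finset.mem_filter.1 hi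
  have h := congrArg (fun f : F[X][X] => (f.coeff (e i)).coeff (p i).natDegree) hg
  simp only [finsetSum_coeff, coeff_smul, coeff_zero] at h
  rw [Finset.sum_eq_single i] at h
  · rw [coeff_monomial_same, coeff_natDegree, smul_eq_mul] at h
    exact mul_ne_zero hgi (leadingCoeff_ne_zero.2 (hp i)) h
  · intro j hj hji
    by_cases hgj : g j = 0
    · simp [hgj]
    by_cases he : e j = e i
    · have hd : (p j).natDegree < (p i).natDegree :=
        lt_of_le_of_ne (hmax j (Finset.mem_filter.2 ⟨hj, hgj⟩))
          fun hd => hji (hinj (Prod.ext hd he))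
      rw [he, coeff_monomial_same, coeff_eq_zero_of_natDegree_lt hd, smul_zero]
    · rw [coeff_monomial_of_ne _ (Ne.symm he), coeff_zero, smul_zero]
  · exact fun h => (h his).elim

/-- The operator on `F[X][Y]` by which `A` acts: substitute `X ↦ qX + r`, then multiply by `Y`. -/
noncomputable def opA (q r : F) : Module.End F F[X][X] :=
  LinearMap.mulLeft F (X : F[X][X]) ∘ₗ
    (mapAlgHom (aeval (C q * X + C r) : F[X] →ₐ[F] F[X])).toLinearMap

/-- The operator on `F[X][Y]` by which `B` acts: multiplication by `X`. -/
noncomputable def opB (F : Type*) [Field F] : Module.End F F[X][X] :=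
  LinearMap.mulLeft F (C X : F[X][X])

theorem opA_mul_opB (q r : F) : opA q r * opB F - q • (opB F * opA q r) = r • opA q r := by
  ext1 f
  have hsmul (c : F) (g : F[X][X]) : c • g = C (C c) * g := by
    rw [← smul_eq_C_mul, ← algebraMap_eq, algebraMap_smul]
  simp only [opA, opB, LinearMap.sub_apply, LinearMap.smul_apply, Module.End.mul_apply,
    LinearMap.comp_apply, LinearMap.mulLeft_apply, AlgHom.toLinearMap_apply, map_mul, hsmul,
    coe_mapAlgHom, map_C, RingHom.coe_coe, aeval_X, map_add]
  ring

/-- The action of `U_q(r, 0)` on `F[X][Y]`. -/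
noncomputable def polyRep (q r : F) : Uq q r 0 →ₐ[F] Module.End F F[X][X] :=
  RingQuot.liftAlgHom F ⟨FreeAlgebra.lift F fun
    | Letter.A => opA q r
    | Letter.B => opB F, by
      rintro _ _ ⟨⟩
      simpa using opA_mul_opB q r⟩

theorem polyRep_genA (q r : F) : polyRep q r (genA q r 0) = opA q r := by
  simp [polyRep, genA]

theorem polyRep_genB (q r : F) : polyRep q r (genB q r 0) = opB F := by
  simp [polyRep, genB]

theorem polyRep_genA_pow_one (q r : F) (k : ℕ) :
    polyRep q r (genA q r 0 ^ k) 1 = monomial k 1 := by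
  rw [map_pow, polyRep_genA]
  induction k with
  | zero => simp
  | succ k ih =>
    rw [pow_succ', Module.End.mul_apply, ih]
    simp [opA, X_mul_monomial]

theorem polyRep_genB_pow_monomial (q r : F) (n k : ℕ) (p : F[X]) :
    polyRep q r (genB q r 0 ^ n) (monomial k p) = monomial k (X ^ n * p) := by
  rw [map_pow, polyRep_genB]
  induction n with
  | zero => simp
  | succ n ih =>
    rw [pow_succ', Module.End.mul_apply, ih, opB, LinearMap.mulLeft_apply, C_mul_monomial,
      pow_succ', mul_assoc]

theorem polyRep_elemD_pow_monomial (q r : F) (n k : ℕ) (p : F[X]) :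
    polyRep q r (elemD q r ^ n) (monomial k p)
      = monomial k ((C (q - 1) * X + C r) ^ n * p) := by
  induction n with
  | zero => simp
  | succ n ih =>
    have hB := polyRep_genB_pow_monomial q r 1 k ((C (q - 1) * X + C r) ^ n * p)
    rw [pow_one, pow_one] at hB
    rw [pow_succ', map_mul, Module.End.mul_apply, ih, elemD, map_add, map_smul,
      AlgHom.commutes, LinearMap.add_apply, LinearMap.smul_apply, hB,
      Module.algebraMap_end_apply, smul_monomial, smul_monomial, ← map_add, smul_eq_C_mul,
      smul_eq_C_mul, pow_succ']
    congr 1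
    ring

theorem linearIndependent_listed {q : F} (hq : q ≠ 0) (hq1 : q - 1 ≠ 0) (r : F) :
    LinearIndependent F (listed q r 0) := by
  let P : F[X] := C (q - 1) * X + C r
  have hP : P.natDegree = 1 := natDegree_linear hq1
  have hP0 : P ≠ 0 := fun h => by simp [h] at hP
  let p : Idx → F[X]
    | Idx.a => 1
    | Idx.b => X
    | Idx.bc n m => C (q ^ ((m : ℕ).choose 2)) * (X ^ n * P ^ (m : ℕ))
    | Idx.ca m _ => C (q ^ ((m : ℕ).choose 2)) * P ^ (m : ℕ)
  let e : Idx → ℕ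
    | Idx.a => 1
    | Idx.b => 0
    | Idx.bc _ m => m
    | Idx.ca m k => m + k
  let d : Idx → ℕ
    | Idx.a => 0
    | Idx.b => 1
    | Idx.bc n m => n + m
    | Idx.ca m _ => m
  have hp0 (i : Idx) : p i ≠ 0 := by
    cases i <;> simp [p, hq, hP0]
  have hd (i : Idx) : (p i).natDegree = d i := by
    cases i with
    | a => simp [p, d]
    | b => simp [p, d]
    | bc n m =>
      simp only [p, d]
      rw [natDegree_C_mul (pow_ne_zero _ hq),
        natDegree_mul (pow_ne_zero _ X_ne_zero) (pow_ne_zero _ hP0), natDegree_X_pow,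
        natDegree_pow, hP, mul_one]
    | ca m k =>
      simp only [p, d]
      rw [natDegree_C_mul (pow_ne_zero _ hq), natDegree_pow, hP, mul_one]
  have hinj : Function.Injective fun i => ((p i).natDegree, e i) := by
    intro i j hij
    simp only [hd, Prod.mk.injEq] at hij
    obtain ⟨h₁, h₂⟩ := hij
    have hpos (m : ℕ+) : 0 < (m : ℕ) := m.pos
    cases i <;> cases j <;> simp only [d, e] at h₁ h₂ <;> grind [PNat.coe_inj]
  have hval (i : Idx) : polyRep q r (listed q r 0 i) 1 = monomial (e i) (p i) := by
    cases i with
    | a => simpa [listed, p, e] using polyRep_genA_pow_one q r 1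
    | b =>
      have := polyRep_genB_pow_monomial q r 1 0 1
      simpa [listed, p, e] using this
    | bc n m =>
      simp only [listed, p, e]
      rw [elemC_pow, mul_smul_comm, map_smul, LinearMap.smul_apply, map_mul, map_mul,
        Module.End.mul_apply, Module.End.mul_apply, polyRep_genA_pow_one,
        polyRep_elemD_pow_monomial, polyRep_genB_pow_monomial, smul_monomial, smul_eq_C_mul,
        mul_one]
    | ca m k =>
      simp only [listed, p, e]
      rw [elemC_pow, smul_mul_assoc, mul_assoc, ← pow_add, map_smul, LinearMap.smul_apply, map_mul,
        Module.End.mul_apply, polyRep_genA_pow_one, polyRep_elemD_pow_monomial, smul_monomial,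
        smul_eq_C_mul, mul_one]
  refine LinearIndependent.of_comp
    (LinearMap.applyₗ (R := F) (M := F[X][X]) (M₂ := F[X][X]) 1 ∘ₗ (polyRep q r).toLinearMap) ?_
  convert linearIndependent_monomial p e hp0 hinj using 1
  exact funext hval

end Algebra

end QDeformed

theorem theorem5 {F : Type*} [Field F] [CharZero F] (q r : F)
    (hq : q ≠ 0) (hroot : ∀ n : ℕ, 1 ≤ n → q ^ n ≠ 1) (hr : r ≠ 0) :
    ∃ b : Module.Basis QDeformed.Idx F (QDeformed.lieL q r 0),
      ∀ i : QDeformed.Idx, (b i : QDeformed.Uq q r 0) = QDeformed.listed q r 0 i := by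
  have hq1 : q - 1 ≠ 0 := sub_ne_zero.2 (by simpa using hroot 1 le_rfl)
  have hspan : Submodule.span F (Set.range (QDeformed.listed q r 0))
      = (QDeformed.lieL q r 0).toSubmodule :=
    le_antisymm (Submodule.span_le.2 (QDeformed.range_listed_subset_lieL hroot r))
      (QDeformed.lieL_le_span hq hq1 r)
  refine ⟨(Module.Basis.span (QDeformed.linearIndependent_listed hq hq1 r)).map
    (LinearEquiv.ofEq _ _ hspan), fun i => ?_⟩
  exact congrArg Subtype.val <|
    Module.Basis.span_apply (QDeformed.linearIndependent_listed hq hq1 r) i
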